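/- Let $K=\mathbb{R}$ or $K=\mathbb{C}$, let $(\Omega,\mathcal F,P)$ be a probability space and let $n$ be a positive integer. Let $L^0(\mathcal F,K)$ be the algebra of $P$-almost sure equivalence classes of $K$-valued random variables on $(\Omega,\mathcal F,P)$, and let $L^0(\mathcal F,K^n)$ be the $L^0(\mathcal F,K)$-module of equivalence classes of $K^n$-valued random variables, with the module multiplication $\lambda\cdot(\xi_1,\dots,\xi_n)=(\lambda\xi_1,\dots,\lambda\xi_n)$. For $x=(\xi_1,\dots,\xi_n)$ and $y=(\eta_1,\dots,\eta_n)$ in $L^0(\mathcal F,K^n)$ put $\langle x,y\rangle=\sum_{i=1}^n\xi_i\overline{\eta_i}\in L^0(\mathcal F,K)$. For $A\in\mathcal F$ let $\tilde I_A\in L^0(\mathcal F,K)$ be the equivalence class of the characteristic function of $A$. A subset $G$ of $L^0(\mathcal F,K^n)$ has the countable concatenation property if for every sequence $(A_k)_{k\in\mathbb N}$ of pairwise disjoint sets in $\mathcal F$ with $\bigcup_k A_k=\Omega$ and every sequence $(x_k)_{k\in\mathbb N}$ in $G$ there is $z\in G$ with $\tilde I_{A_k}z=\tilde I_{A_k}x_k$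 for all $k\in\mathbb N$. Let $M$ be an $L^0(\mathcal F,K)$-submodule of $L^0(\mathcal F,K^n)$ such that $M\neq L^0(\mathcal F,K^n)$ and $M$ has the countable concatenation property. Then there exists $x\in L^0(\mathcal F,K^n)$ such that $x\neq 0$ and $\langle x,y\rangle=0$ for all $y\in M$. -/

import Mathlib

open MeasureTheory

noncomputable section

namespace RandomModule

/-- `L⁰(𝓕, K)`: the algebra of equivalence classes of `K`-valued random variables. -/
abbrev L0 {Ω : Type*} [MeasurableSpace Ω] (P : Measure Ω) (K : Type*) [RCLike K] : Type _ :=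
  Ω →ₘ[P] K

/-- `L⁰(𝓕, Kⁿ)`: the equivalence classes of `Kⁿ`-valued random variables. -/
abbrev L0Vec {Ω : Type*} [MeasurableSpace Ω] (P : Measure Ω) (K : Type*) [RCLike K] (n : ℕ) :
    Type _ :=
  Ω →ₘ[P] EuclideanSpace K (Fin n)

section

variable {Ω : Type*} [MeasurableSpace Ω] {P : Measure Ω} {K : Type*} [RCLike K] {n : ℕ}

/-- The pointwise ring structure on `L⁰(𝓕, K)`, extending Mathlib's additive group and
multiplicative monoid structures on it. -/
instance : CommRing (L0 P K) :=
  { (inferInstance : AddCommGroup (L0 P K)), (inferInstance : CommMonoid (L0 P K)) with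
    left_distrib := fun a b c => AEEqFun.toGerm_injective (by
      simp only [AEEqFun.mul_toGerm, AEEqFun.add_toGerm, mul_add])
    right_distrib := fun a b c => AEEqFun.toGerm_injective (by
      simp only [AEEqFun.mul_toGerm, AEEqFun.add_toGerm, add_mul])
    zero_mul := fun a => AEEqFun.toGerm_injective (by
      simp only [AEEqFun.mul_toGerm, AEEqFun.zero_toGerm, zero_mul])
    mul_zero := fun a => AEEqFun.toGerm_injective (by
      simp only [AEEqFun.mul_toGerm, AEEqFun.zero_toGerm, mul_zero]) }

/-- The module multiplication of `L⁰(𝓕, K)` on `L⁰(𝓕, Kⁿ)`, induced by the pointwise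
(coordinatewise) multiplication of representatives. -/
instance : SMul (L0 P K) (L0Vec P K n) :=
  ⟨fun c x => AEEqFun.comp₂ (fun (a : K) (v : EuclideanSpace K (Fin n)) => a • v)
    continuous_smul c x⟩

theorem smul_mk_mk (f : Ω → K) (hf : AEStronglyMeasurable f P)
    (g : Ω → EuclideanSpace K (Fin n)) (hg : AEStronglyMeasurable g P) :
    (AEEqFun.mk f hf : L0 P K) • (AEEqFun.mk g hg : L0Vec P K n)
      = AEEqFun.mk (fun ω => f ω • g ω) (hf.smul hg) :=
  rfl

instance : Module (L0 P K) (L0Vec P K n) where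
  one_smul x := by
    induction x using AEEqFun.induction_on with
    | _ g hg =>
      rw [AEEqFun.one_def, smul_mk_mk]
      simp
  mul_smul c d x := by
    induction c using AEEqFun.induction_on with
    | _ f hf =>
    induction d using AEEqFun.induction_on with
    | _ f' hf' =>
    induction x using AEEqFun.induction_on with
    | _ g hg =>
      simp only [AEEqFun.mk_mul_mk, smul_mk_mk, Pi.mul_apply, mul_smul]
  smul_zero c := by
    induction c using AEEqFun.induction_on with
    | _ f hf =>
      rw [AEEqFun.zero_def, smul_mk_mk]
      simp
  smul_add c x y := by
    induction c using AEEqFun.induction_on with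
    | _ f hf =>
    induction x using AEEqFun.induction_on with
    | _ g hg =>
    induction y using AEEqFun.induction_on with
    | _ g' hg' =>
      simp only [AEEqFun.mk_add_mk, smul_mk_mk, Pi.add_apply, smul_add]
      rfl
  add_smul c d x := by
    induction c using AEEqFun.induction_on with
    | _ f hf =>
    induction d using AEEqFun.induction_on with
    | _ f' hf' =>
    induction x using AEEqFun.induction_on with
    | _ g hg =>
      simp only [AEEqFun.mk_add_mk, smul_mk_mk, Pi.add_apply, add_smul]
      rfl
  zero_smul x := by
    induction x using AEEqFun.induction_on with
    | _ g hg =>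
      rw [AEEqFun.zero_def, smul_mk_mk]
      simp only [zero_smul]
      rfl

/-- The `L⁰`-valued inner product `⟨x, y⟩ = ∑ i, ξᵢ * conj ηᵢ` on `L⁰(𝓕, Kⁿ)`. -/
def innerL0 (x y : L0Vec P K n) : L0 P K :=
  AEEqFun.comp₂
    (fun v w : EuclideanSpace K (Fin n) => ∑ i, v i * (starRingEnd K) (w i))
    (by
      simp only [Function.uncurry_def]
      have h := RCLike.continuous_conj (K := K)
      fun_prop) x y

/-- The equivalence class in `L⁰(𝓕, K)` of the characteristic function of `A`. -/
def indL0 (P : Measure Ω) (K : Type*) [RCLike K] (A : Set Ω) (hA : MeasurableSet A) : L0 P K :=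
  AEEqFun.mk (A.indicator fun _ => (1 : K))
    (stronglyMeasurable_const.indicator hA).aestronglyMeasurable

/-- A subset `G` of an `L⁰(𝓕, K)`-module has the countable concatenation property: for every
countable measurable partition `(A k)` of `Ω` and every sequence `(x k)` in `G` there is `z ∈ G`
which is the concatenation of the `x k` along the `A k`. -/
def HasCountableConcatenation {E : Type*} [AddCommGroup E] [Module (L0 P K) E]
    (G : Set E) : Prop :=
  ∀ (A : ℕ → Set Ω) (hA : ∀ k, MeasurableSet (A k)),
    Pairwise (fun i j => Disjoint (A i) (A j)) → (⋃ k, A k) = Set.univ →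
    ∀ x : ℕ → E, (∀ k, x k ∈ G) →
      ∃ z ∈ G, ∀ k, indL0 P K (A k) (hA k) • z = indL0 P K (A k) (hA k) • x k

end

end RandomModule

end

/-!
The fibres of `L⁰(𝓕, Kⁿ)` have dimension at most `n`, so there is a largest `k` for which `M`
contains `k` elements that are pointwise orthonormal on some event of positive measure inside a
given one. On that event every element of `M` is pointwise a combination of these `k` elements,
since otherwise a Gram–Schmidt step would lengthen the family on a smaller event.
If `v ∉ M`, an exhaustion argument, which is where countable concatenation enters, yields an event
of positive measure such that `v` agrees with an element of `M` on no non-null part of it. Choosing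
the orthonormal family there, the residual of `v` after pointwise projection onto the span of the
family is nonzero and orthogonal to `M`.
-/

open Set
open scoped InnerProductSpace

namespace RandomModule

section Exhaustion

variable {Ω : Type*} [MeasurableSpace Ω]

theorem exists_mem_forall_measure_diff_eq_zero (μ : Measure Ω) [SFinite μ] {C : Set (Set Ω)}
    (hCm : ∀ A ∈ C, MeasurableSet A) (hCne : C.Nonempty)
    (hCU : ∀ A : ℕ → Set Ω, (∀ k, A k ∈ C) → ⋃ k, A k ∈ C) :
    ∃ A ∈ C, ∀ B ∈ C, μ (B \ A) = 0 := by
  set ν := μ.toFinite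
  obtain ⟨u, -, hu, huC⟩ := exists_seq_tendsto_sSup (hCne.image ν) (OrderTop.bddAbove _)
  choose A hAC hAu using huC
  have hsup : sSup (ν '' C) ≤ ν (⋃ k, A k) :=
    le_of_tendsto' hu fun k => hAu k ▸ measure_mono (subset_iUnion A k)
  refine ⟨⋃ k, A k, hCU A hAC, fun B hB => absolutelyContinuous_toFinite μ ?_⟩
  have hunion : B ∪ ⋃ k, A k ∈ C := by
    have := hCU (fun k => Nat.casesOn k B A) (by rintro (_ | k); exacts [hB, hAC k])
    rwa [← union_iUnion_nat_succ] at this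
  have hle : ν (B ∪ ⋃ k, A k) ≤ ν (⋃ k, A k) := (le_sSup (mem_image_of_mem ν hunion)).trans hsup
  exact union_ae_eq_right.1 (ae_eq_of_subset_of_measure_ge subset_union_right hle
    (hCm _ (hCU A hAC)).nullMeasurableSet (measure_ne_top ν _)).symm

theorem exists_measurable_nat_forall_mem_iUnion {A : ℕ → Set Ω} (hA : ∀ k, MeasurableSet (A k)) :
    ∃ N : Ω → ℕ, Measurable N ∧ ∀ ω ∈ ⋃ k, A k, ω ∈ A (N ω) := by
  classical
  have hex : ∀ ω, ∃ k, ω ∈ ⋃ k, A k → ω ∈ A k := fun ω => by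
    by_cases hω : ω ∈ ⋃ k, A k
    · exact (mem_iUnion.1 hω).imp fun k hk _ => hk
    · exact ⟨0, fun h => absurd h hω⟩
  refine ⟨_, measurable_find hex fun k => ?_, fun ω => Nat.find_spec (hex ω)⟩
  exact (MeasurableSet.iUnion hA).imp (hA k)

end Exhaustion

section Orthonormal

variable {K E ι : Type*} [RCLike K] [NormedAddCommGroup E] [InnerProductSpace K E]

theorem inner_sub_sum_inner_smul_eq_zero [Fintype ι] {y : ι → E} (hy : Orthonormal K y) (x : E)
    (i : ι) : ⟪y i, x - ∑ j, ⟪y j, x⟫_K • y j⟫_K = 0 := by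
  rw [inner_sub_right, hy.inner_right_fintype, sub_self]

theorem orthonormal_vecCons_normalize_sub_sum {k : ℕ} {y : Fin k → E} (hy : Orthonormal K y)
    {x : E} (hx : x ≠ ∑ j, ⟪y j, x⟫_K • y j) :
    Orthonormal K (Matrix.vecCons
      ((‖x - ∑ j, ⟪y j, x⟫_K • y j‖⁻¹ : K) • (x - ∑ j, ⟪y j, x⟫_K • y j)) y) := by
  refine orthonormal_vecCons_iff.2 ⟨norm_smul_inv_norm (sub_ne_zero.2 hx), fun i => ?_, hy⟩
  rw [inner_smul_left, inner_eq_zero_symm.1 (inner_sub_sum_inner_smul_eq_zero hy x i), mul_zero]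

end Orthonormal

variable {Ω : Type*} [MeasurableSpace Ω] {P : Measure Ω} {K : Type*} [RCLike K] {n : ℕ}

section Representatives

theorem coeFn_smul (c : L0 P K) (x : L0Vec P K n) : ⇑(c • x) =ᵐ[P] fun ω => c ω • x ω :=
  AEEqFun.coeFn_comp₂ _ _ c x

theorem coeFn_mk_smul {f : Ω → K} (hf : AEStronglyMeasurable f P) (x : L0Vec P K n) :
    ⇑((AEEqFun.mk f hf : L0 P K) • x) =ᵐ[P] fun ω => f ω • x ω := by
  filter_upwards [coeFn_smul (AEEqFun.mk f hf) x, AEEqFun.coeFn_mk f hf] with ω hsmul hmk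
  rw [hsmul, hmk]

theorem coeFn_innerL0 (x y : L0Vec P K n) : ⇑(innerL0 x y) =ᵐ[P] fun ω => ⟪y ω, x ω⟫_K :=
  AEEqFun.coeFn_comp₂ _ _ x y

theorem coeFn_sum {ι E : Type*} [TopologicalSpace E] [AddCommMonoid E] [ContinuousAdd E]
    (s : Finset ι) (f : ι → Ω →ₘ[P] E) : ⇑(∑ i ∈ s, f i) =ᵐ[P] fun ω => ∑ i ∈ s, f i ω := by
  classical
  induction s using Finset.induction_on with
  | empty => exact AEEqFun.coeFn_zero
  | insert i s hi ih =>
    filter_upwards [AEEqFun.coeFn_add (f i) (∑ j ∈ s, f j), ih] with ω hadd hsum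
    rw [Finset.sum_insert hi, hadd, Pi.add_apply, hsum, Finset.sum_insert hi]

theorem coeFn_indL0_smul {A : Set Ω} (hA : MeasurableSet A) (x : L0Vec P K n) :
    ⇑(indL0 P K A hA • x) =ᵐ[P] A.indicator x := by
  refine (coeFn_mk_smul _ x).trans (.of_eq (funext fun ω => ?_))
  by_cases hω : ω ∈ A <;> simp [hω]

theorem indL0_smul_eq_iff {A : Set Ω} (hA : MeasurableSet A) {x y : L0Vec P K n} :
    indL0 P K A hA • x = indL0 P K A hA • y ↔ x =ᵐ[P.restrict A] y := by
  rw [AEEqFun.ext_iff, Filter.EventuallyEq, Filter.EventuallyEq, ae_restrict_iff' hA]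
  refine Filter.eventually_congr ?_
  filter_upwards [coeFn_indL0_smul hA x, coeFn_indL0_smul hA y] with ω hx hy
  by_cases hω : ω ∈ A <;> simp [hx, hy, hω]

theorem measurableSet_coeFn_ne (x y : L0Vec P K n) : MeasurableSet {ω | x ω ≠ y ω} :=
  (x.stronglyMeasurable.measurableSet_eq_fun y.stronglyMeasurable).compl

end Representatives

section CountableConcatenation

variable {G : Set (L0Vec P K n)}

theorem HasCountableConcatenation.exists_ae_eq (hG : HasCountableConcatenation (P := P) (K := K) G)
    {N : Ω → ℕ} (hN : Measurable N) {x : ℕ → L0Vec P K n} (hx : ∀ k, x k ∈ G) :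
    ∃ z ∈ G, ∀ᵐ ω ∂P, z ω = x (N ω) ω := by
  have hNm : ∀ k, MeasurableSet (N ⁻¹' {k}) := fun k => hN (measurableSet_singleton k)
  have hNU : ⋃ k, N ⁻¹' {k} = univ := iUnion_eq_univ_iff.2 fun ω => ⟨N ω, rfl⟩
  obtain ⟨z, hzG, hz⟩ := hG _ hNm (pairwise_disjoint_fiber N) hNU x hx
  refine ⟨z, hzG, ?_⟩
  filter_upwards [ae_all_iff.2 fun k => (ae_restrict_iff' (hNm k)).1
    ((indL0_smul_eq_iff (hNm k)).1 (hz k))] with ω hω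
  exact hω (N ω) rfl

/-- The events on which `v` agrees almost surely with an element of `G`. For a submodule `G` these
are the measurable `A` with `indL0 P K A _ • v ∈ G`. -/
def agreementSets (G : Set (L0Vec P K n)) (v : L0Vec P K n) : Set (Set Ω) :=
  {A | MeasurableSet A ∧ ∃ y ∈ G, v =ᵐ[P.restrict A] y}

theorem HasCountableConcatenation.iUnion_mem_agreementSets
    (hG : HasCountableConcatenation (P := P) (K := K) G) {v : L0Vec P K n} {A : ℕ → Set Ω}
    (hA : ∀ k, A k ∈ agreementSets G v) : ⋃ k, A k ∈ agreementSets G v := by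
  choose hAm x hxG hx using hA
  obtain ⟨N, hN, hNA⟩ := exists_measurable_nat_forall_mem_iUnion hAm
  obtain ⟨z, hzG, hz⟩ := hG.exists_ae_eq hN hxG
  refine ⟨.iUnion hAm, z, hzG, (ae_restrict_iff' (.iUnion hAm)).2 ?_⟩
  filter_upwards [hz, ae_all_iff.2 fun k => (ae_restrict_iff' (hAm k)).1 (hx k)] with ω hzω hxω hω
  rw [hzω, hxω _ (hNA ω hω)]

theorem HasCountableConcatenation.exists_forall_agreementSets_measure_eq_zero [SFinite P]
    (hG : HasCountableConcatenation (P := P) (K := K) G) (hGne : G.Nonempty) {v : L0Vec P K n}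
    (hv : v ∉ G) :
    ∃ C, MeasurableSet C ∧ P C ≠ 0 ∧ ∀ B ∈ agreementSets G v, B ⊆ C → P B = 0 := by
  obtain ⟨x, hxG⟩ := hGne
  have hempty : ∅ ∈ agreementSets G v := ⟨.empty, x, hxG, by simp [Filter.EventuallyEq]⟩
  obtain ⟨A, ⟨hA, y, hyG, hy⟩, hmax⟩ := exists_mem_forall_measure_diff_eq_zero P
    (fun _ h => h.1) ⟨∅, hempty⟩ fun _ => hG.iUnion_mem_agreementSets
  refine ⟨Aᶜ, hA.compl, fun hnull => hv ?_, fun B hB hBA => ?_⟩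
  · have hvy : v = y := AEEqFun.ext <| by
      rwa [Measure.restrict_eq_self_of_ae_mem (compl_mem_ae_iff.1 (by rwa [compl_compl]))] at hy
    rwa [hvy]
  · rw [← (disjoint_left.2 hBA).sdiff_eq_left]
    exact hmax B hB

end CountableConcatenation

section OrthonormalFamilies

variable {ι : Type*} {B : Set Ω}

/-- The values of the family `y` are orthonormal at almost every point of `B`. -/
def IsOrthonormalOn (y : ι → L0Vec P K n) (B : Set Ω) : Prop :=
  ∀ᵐ ω ∂P.restrict B, Orthonormal K fun j => y j ω

/-- The expansion `∑ j, ⟨x, y j⟩ • y j` of `x` along `y`. Where `y` is pointwise orthonormal, it is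
the pointwise orthogonal projection of `x` onto the span of `y`. -/
def expansion [Fintype ι] (y : ι → L0Vec P K n) (x : L0Vec P K n) : L0Vec P K n :=
  ∑ j, innerL0 x (y j) • y j

theorem expansion_mem [Fintype ι] {M : Submodule (L0 P K) (L0Vec P K n)} {y : ι → L0Vec P K n}
    (hy : ∀ j, y j ∈ M) (x : L0Vec P K n) : expansion y x ∈ M :=
  M.sum_mem fun j _ => M.smul_mem _ (hy j)

theorem coeFn_expansion [Fintype ι] (y : ι → L0Vec P K n) (x : L0Vec P K n) :
    ⇑(expansion y x) =ᵐ[P] fun ω => ∑ j, ⟪y j ω, x ω⟫_K • y j ω := by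
  filter_upwards [coeFn_sum Finset.univ fun j => innerL0 x (y j) • y j,
    ae_all_iff.2 fun j => coeFn_smul (innerL0 x (y j)) (y j),
    ae_all_iff.2 fun j => coeFn_innerL0 x (y j)] with ω hsum hsmul hinner
  simp only [expansion, hsum, hsmul, hinner]

theorem coeFn_sub_expansion [Fintype ι] (y : ι → L0Vec P K n) (x : L0Vec P K n) :
    ⇑(x - expansion y x) =ᵐ[P] fun ω => x ω - ∑ j, ⟪y j ω, x ω⟫_K • y j ω := by
  filter_upwards [AEEqFun.coeFn_sub x (expansion y x), coeFn_expansion y x] with ω hsub hexp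
  rw [hsub, Pi.sub_apply, hexp]

theorem IsOrthonormalOn.card_le [Fintype ι] {y : ι → L0Vec P K n} (hy : IsOrthonormalOn y B)
    (hB : P B ≠ 0) : Fintype.card ι ≤ n := by
  have : (ae (P.restrict B)).NeBot := ae_restrict_neBot.2 hB
  obtain ⟨ω, hω⟩ := Filter.Eventually.exists hy
  simpa using hω.linearIndependent.fintype_card_le_finrank

theorem IsOrthonormalOn.exists_smul_sub_expansion {k : ℕ} {y : Fin k → L0Vec P K n}
    (hy : IsOrthonormalOn y B) (x : L0Vec P K n) :
    ∃ c : L0 P K, IsOrthonormalOn (Matrix.vecCons (c • (x - expansion y x)) y)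
      (B ∩ {ω | x ω ≠ expansion y x ω}) := by
  set r := x - expansion y x
  have hm : AEStronglyMeasurable (fun ω => (‖r ω‖⁻¹ : K)) P :=
    (RCLike.measurable_ofReal.comp r.measurable.norm).inv.aestronglyMeasurable
  refine ⟨AEEqFun.mk _ hm, ?_⟩
  filter_upwards [ae_restrict_of_ae_restrict_of_subset inter_subset_left hy,
    ae_restrict_of_ae_restrict_of_subset inter_subset_right
      (ae_restrict_mem (measurableSet_coeFn_ne x (expansion y x))),
    ae_restrict_of_ae (coeFn_mk_smul hm r), ae_restrict_of_ae (coeFn_expansion y x),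
    ae_restrict_of_ae (coeFn_sub_expansion y x)] with ω hyω hne hsmul hexp hr
  have hcons : (fun j => Matrix.vecCons ((AEEqFun.mk _ hm : L0 P K) • r) y j ω) =
      Matrix.vecCons ((‖r ω‖⁻¹ : K) • r ω) fun j => y j ω := by
    funext j
    cases j using Fin.cases
    exacts [hsmul, rfl]
  rw [hcons, hr]
  exact orthonormal_vecCons_normalize_sub_sum hyω (hexp ▸ hne)

theorem exists_isOrthonormalOn_forall_ae_eq_expansion (M : Submodule (L0 P K) (L0Vec P K n))
    {C : Set Ω} (hC : MeasurableSet C) (hPC : P C ≠ 0) :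
    ∃ B ⊆ C, MeasurableSet B ∧ P B ≠ 0 ∧ ∃ (k : ℕ) (y : Fin k → L0Vec P K n),
      (∀ j, y j ∈ M) ∧ IsOrthonormalOn y B ∧ ∀ x ∈ M, x =ᵐ[P.restrict B] expansion y x := by
  let S : Set ℕ := {k | ∃ B ⊆ C, MeasurableSet B ∧ P B ≠ 0 ∧
    ∃ y : Fin k → L0Vec P K n, (∀ j, y j ∈ M) ∧ IsOrthonormalOn y B}
  have hzero : 0 ∈ S :=
    ⟨C, subset_rfl, hC, hPC, Fin.elim0, fun j => j.elim0, ae_of_all _ fun _ => .of_isEmpty _⟩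
  have hbdd : BddAbove S := ⟨n, by
    rintro k ⟨B, -, -, hPB, y, -, hy⟩
    simpa using hy.card_le hPB⟩
  obtain ⟨k, ⟨B, hBC, hB, hPB, y, hyM, hy⟩, hmax⟩ := hbdd.exists_isGreatest_of_nonempty ⟨0, hzero⟩
  refine ⟨B, hBC, hB, hPB, k, y, hyM, hy, fun x hx => ?_⟩
  by_contra hne
  obtain ⟨c, hc⟩ := hy.exists_smul_sub_expansion x
  have hmeas := measurableSet_coeFn_ne x (expansion y x)
  have hpos : P (B ∩ {ω | x ω ≠ expansion y x ω}) ≠ 0 := by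
    rwa [inter_comm, ← Measure.restrict_apply hmeas]
  refine (hmax ⟨_, inter_subset_left.trans hBC, hB.inter hmeas, hpos, _, ?_, hc⟩).not_gt
    k.lt_succ_self
  exact Fin.cases (M.smul_mem c (M.sub_mem hx (expansion_mem hyM x))) hyM

theorem IsOrthonormalOn.innerL0_indL0_smul_sub_expansion_eq_zero [Fintype ι]
    {y : ι → L0Vec P K n} (hy : IsOrthonormalOn y B) (hB : MeasurableSet B) {u : L0Vec P K n}
    (hu : u =ᵐ[P.restrict B] expansion y u) (x : L0Vec P K n) :
    innerL0 (indL0 P K B hB • (x - expansion y x)) u = 0 := by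
  refine AEEqFun.ext (((coeFn_innerL0 _ u).trans ?_).trans AEEqFun.coeFn_zero.symm)
  filter_upwards [coeFn_indL0_smul hB (x - expansion y x), coeFn_sub_expansion y x,
    coeFn_expansion y u, (ae_restrict_iff' hB).1 hu, (ae_restrict_iff' hB).1 hy]
    with ω hind hsub hexp huω hyω
  by_cases hω : ω ∈ B
  · rw [hind, indicator_of_mem hω, hsub, huω hω, hexp, sum_inner]
    refine Finset.sum_eq_zero fun j _ => ?_
    rw [inner_smul_left, inner_sub_sum_inner_smul_eq_zero (hyω hω), mul_zero]
  · rw [hind, indicator_of_notMem hω, inner_zero_right, Pi.zero_apply]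

end OrthonormalFamilies

end RandomModule

open RandomModule in
theorem mainTheorem4_general {Ω : Type*} [MeasurableSpace Ω] (P : Measure Ω) [SFinite P]
    {K : Type*} [RCLike K] (n : ℕ) (M : Submodule (L0 P K) (L0Vec P K n)) (hproper : M ≠ ⊤)
    (hM : HasCountableConcatenation (P := P) (K := K) (M : Set (L0Vec P K n))) :
    ∃ x : L0Vec P K n, x ≠ 0 ∧ ∀ y ∈ M, innerL0 x y = 0 := by
  obtain ⟨v, hv⟩ := SetLike.exists_not_mem_of_ne_top M hproper rfl
  obtain ⟨C, hC, hPC, hnull⟩ :=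
    hM.exists_forall_agreementSets_measure_eq_zero ⟨0, M.zero_mem⟩ hv
  obtain ⟨B, hBC, hB, hPB, k, y, hyM, hy, hspan⟩ :=
    exists_isOrthonormalOn_forall_ae_eq_expansion M hC hPC
  refine ⟨indL0 P K B hB • (v - expansion y v), fun hzero => hPB (hnull B ?_ hBC), fun u hu =>
    hy.innerL0_indL0_smul_sub_expansion_eq_zero hB (hspan u hu) v⟩
  refine ⟨hB, expansion y v, expansion_mem hyM v, (indL0_smul_eq_iff hB).1 ?_⟩
  exact sub_eq_zero.1 ((smul_sub (indL0 P K B hB) v (expansion y v)).symm.trans hzero)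

theorem mainTheorem4 {Ω : Type*} [MeasurableSpace Ω] (P : Measure Ω) [IsProbabilityMeasure P]
    {K : Type*} [RCLike K] (n : ℕ)
    (M : Submodule (RandomModule.L0 P K) (RandomModule.L0Vec P K n))
    (hproper : M ≠ ⊤)
    (hM : RandomModule.HasCountableConcatenation (P := P) (K := K)
      (M : Set (RandomModule.L0Vec P K n))) :
    ∃ x : RandomModule.L0Vec P K n, x ≠ 0 ∧ ∀ y ∈ M, RandomModule.innerL0 x y = 0 :=
  mainTheorem4_general P n M hproper hM
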